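/- Let $V$ be a set and $c:V\times V\to[0,\infty)$ with $c_{xy}=c_{yx}$, $c_{xx}=0$ and $\sum_y c_{xy}<\infty$ for every $x$. Call $x,y$ adjacent, $x\sim y$, if $c_{xy}>0$, and assume that the resulting graph $G$ is connected (it may be infinite, also of infinite degree). All functions are real-valued. Put $$\mathcal E(u,v)=\tfrac12\sum_{s,t\in V}c_{st}(u(s)-u(t))(v(s)-v(t)),\qquad \mathcal E(u)=\mathcal E(u,u),\qquad \operatorname{dom}\mathcal E=\{u:V\to\mathbb R:\ \mathcal E(u)<\infty\},$$ and let $\mathcal H_{\mathcal E}=\operatorname{dom}\mathcal E/\mathbb R\mathbf 1$ with inner product $\mathcal E$. Fix $o\in V$. A current is an antisymmetric $I:V\times V\to\mathbb R$ that vanishes where $c$ does; its dissipation is $D(I)=\tfrac12\sum_{s\sim t}c_{st}^{-1}I(s,t)^2$ (sum over ordered pairs), and the dissipation space consists of the currents with $D(I)<\infty$, with norm $D^{1/2}$. A unit flow from $x$ to $y$ is a current $I$ with $\sum_{t}I(s,t)=\delta_x(s)-\delta_y(s)$ for all $s\in V$. A path from $x$ to $y$ is a finite sequence $\gamma=(x=x_0,x_1,\dots,x_n=y)$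 with $x_{i-1}\sim x_i$; its current is $\chi_\gamma(s,t)=\#\{i:(x_{i-1},x_i)=(s,t)\}-\#\{i:(x_{i-1},x_i)=(t,s)\}$. A current $I$ decomposes into path currents from $x$ to $y$ if $D(I)<\infty$ and there are real coefficients $\xi_\gamma$ with $I=\sum_\gamma\xi_\gamma\chi_\gamma$, summed over all paths from $x$ to $y$, the sum converging unconditionally in the norm of the dissipation space. For a finite connected network, the effective resistance $R(x,y)$ is $v(x)-v(y)$ for any $v$ with $\sum_t c_{st}(v(s)-v(t))=\delta_x(s)-\delta_y(s)$ for all $s$. An exhaustion of $G$ is an increasing sequence of finite connected full subnetworks $G_k$ (all edges of $G$ between vertices of $G_k$, with the same conductances) whose union is $G$. **Theorem.** For every $z\in V$ there is a unique $v_z\in\mathcal H_{\mathcal E}$ with $\mathcal E(v_z,u)=u(z)-u(o)$ for all $u\in\operatorname{dom}\mathcal E$. Let $x,y\in V$. Exhaustions of $G$ exist, and the limit $$R^F(x,y)=\lim_{k\to\infty}R_{G_k}(x,y)$$ exists in $\mathbb R$ and is the same for every exhaustion $(G_k)$ (the terms are defined once $x,y\in G_k$). It satisfies $$\begin{aligned}R^F(x,y)&=(v_x(x)-v_x(y))-(v_y(x)-v_y(y))\\&=\mathcal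 E(v_x-v_y)\\&=\min\{D(I):\ I\text{ is a unit flow from }x\text{ to }y\text{ that decomposes into path currents from }x\text{ to }y\}\\&=\frac1{\min\{\mathcal E(u):\ u\in\operatorname{dom}\mathcal E,\ u(x)=1,\ u(y)=0\}}\qquad(\text{if }x\ne y)\\&=\inf\{\kappa\ge0:\ |v(x)-v(y)|^2\le\kappa\,\mathcal E(v)\ \text{for all }v\in\operatorname{dom}\mathcal E\}\\&=\sup\{|v(x)-v(y)|^2:\ v\in\operatorname{dom}\mathcal E,\ \mathcal E(v)\le1\},\end{aligned}$$ where both minima are attained and the second one is positive. (The last two expressions are the square of the operator norm of $L_{xy}:u\mapsto u(x)-u(y)$ on $\mathcal H_{\mathcal E}$.) -/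

import Mathlib

open Filter Topology

/-- A set of vertices with a conductance function. A *resistance network* is such an object whose
graph (see `ConductanceGraph.graph`) is connected. Vertices of infinite degree are allowed; the
total conductance at each vertex is finite. -/
structure ConductanceGraph (V : Type*) where
  /-- the conductance of a pair of vertices -/
  c : V → V → ℝ
  nonneg : ∀ x y, 0 ≤ c x y
  symm : ∀ x y, c x y = c y x
  diag : ∀ x, c x x = 0
  summable : ∀ x, Summable (c x)

namespace ConductanceGraph

variable {V : Type*}

/-- `x` and `y` are adjacent iff their conductance is positive. -/
def graph (N : ConductanceGraph V) : SimpleGraph V where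
  Adj x y := 0 < N.c x y
  symm := ⟨fun x y h => by rw [N.symm y x]; exact h⟩
  loopless := ⟨fun x h => by rw [N.diag x] at h; exact lt_irrefl _ h⟩

/-- The full subnetwork on a set of vertices: all edges with both endpoints in the set, with the
same conductances. -/
def full (N : ConductanceGraph V) (H : Set V) : ConductanceGraph H where
  c x y := N.c x y
  nonneg x y := N.nonneg x y
  symm x y := N.symm x y
  diag x := N.diag x
  summable x := (N.summable x).comp_injective Subtype.val_injective

/-! ### Laplacian and effective resistance of a finite network -/

/-- The Laplacian `(Δ v)(x) = ∑ y, c x y * (v x - v y)`. -/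
noncomputable def laplacian (N : ConductanceGraph V) (v : V → ℝ) (x : V) : ℝ :=
  ∑' y, N.c x y * (v x - v y)

open Classical in
/-- The characteristic function of a vertex. -/
noncomputable def delta (x : V) : V → ℝ := fun z => if z = x then 1 else 0

open Classical in
/-- The effective resistance between two vertices of a finite connected network: the voltage drop
`v x - v y`, where `v` is a potential with `Δ v = δ_x - δ_y` (one unit of current is inserted
at `x` and withdrawn at `y`). On a finite connected network such a potential exists and the drop
does not depend on its choice, see `exists_potential` and `effectiveResistance_eq`. -/
noncomputable def effectiveResistance (N : ConductanceGraph V) (x y : V) : ℝ :=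
  if h : ∃ v : V → ℝ, ∀ z, N.laplacian v z = delta x z - delta y z then
    h.choose x - h.choose y
  else 0

/-! ### Exhaustions and the free resistance -/

/-- An exhaustion: an increasing sequence of finite connected full subnetworks with union the
whole network. -/
structure Exhaustion (N : ConductanceGraph V) where
  /-- the vertex sets of the subnetworks -/
  verts : ℕ → Finset V
  mono : Monotone verts
  connected : ∀ k, (N.full (verts k : Set V)).graph.Connected
  exhausts : ∀ z, ∃ k, z ∈ verts k

open Classical in
/-- The effective resistance between `x` and `y` computed in the full subnetwork on `H`
(the value is irrelevant, and set to `0`, when `x` or `y` is not in `H`). -/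
noncomputable def resistanceIn (N : ConductanceGraph V) (H : Set V) (x y : V) : ℝ :=
  if h : x ∈ H ∧ y ∈ H then (N.full H).effectiveResistance ⟨x, h.1⟩ ⟨y, h.2⟩ else 0

/-- `R` is the free resistance between `x` and `y`: exhaustions exist, and along every exhaustion
the effective resistances in the full finite subnetworks converge to `R`. -/
def IsFreeResistance (N : ConductanceGraph V) (x y : V) (R : ℝ) : Prop :=
  Nonempty N.Exhaustion ∧
    ∀ K : N.Exhaustion,
      Tendsto (fun k => N.resistanceIn (K.verts k : Set V) x y) atTop (𝓝 R)

/-! ### Energy -/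

/-- `u` belongs to the domain of the energy form. -/
def FiniteEnergy (N : ConductanceGraph V) (u : V → ℝ) : Prop :=
  Summable fun p : V × V => N.c p.1 p.2 * (u p.1 - u p.2) ^ 2

/-- The energy form; meaningful for `u` and `v` of finite energy. -/
noncomputable def energy (N : ConductanceGraph V) (u v : V → ℝ) : ℝ :=
  1 / 2 * ∑' p : V × V, N.c p.1 p.2 * (u p.1 - u p.2) * (v p.1 - v p.2)

/-- `v` is a representative of the element `v_x` of the energy kernel with origin `o`: it has
finite energy and `⟨v, u⟩ = u x - u o` for every `u` of finite energy. Elements of the energy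
space are functions of finite energy modulo constants. -/
def IsEnergyKernel (N : ConductanceGraph V) (o x : V) (v : V → ℝ) : Prop :=
  N.FiniteEnergy v ∧ ∀ u, N.FiniteEnergy u → N.energy v u = u x - u o

/-! ### Currents -/

/-- A current: an antisymmetric function supported on the edges. -/
def IsCurrent (N : ConductanceGraph V) (I : V → V → ℝ) : Prop :=
  (∀ x y, I x y = - I y x) ∧ ∀ x y, N.c x y = 0 → I x y = 0

/-- `I` has finite dissipation. (Off the edges a current vanishes.) -/
def FiniteDissipation (N : ConductanceGraph V) (I : V → V → ℝ) : Prop :=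
  Summable fun p : V × V => (N.c p.1 p.2)⁻¹ * (I p.1 p.2) ^ 2

/-- The dissipation of a current; meaningful if it is finite. Each edge is counted once. -/
noncomputable def dissipation (N : ConductanceGraph V) (I : V → V → ℝ) : ℝ :=
  1 / 2 * ∑' p : V × V, (N.c p.1 p.2)⁻¹ * (I p.1 p.2) ^ 2

/-- `I` is a unit current flow from `a` to `z`. -/
def IsFlow (N : ConductanceGraph V) (a z : V) (I : V → V → ℝ) : Prop :=
  N.IsCurrent I ∧ ∀ x, HasSum (fun y => I x y) (delta a x - delta z x)

open Classical in
/-- The current of a path `(x_0, ..., x_n)`: a unit current along each step `(x_{i-1}, x_i)`.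
A path is a finite sequence of successively adjacent vertices; if it traverses an edge several
times, the contributions add up with their signs. -/
noncomputable def pathCurrent (N : ConductanceGraph V) {x y : V} (γ : N.graph.Walk x y) :
    V → V → ℝ := fun s t =>
  (γ.darts.map fun d =>
    (if d.fst = s ∧ d.snd = t then (1 : ℝ) else 0) -
      (if d.fst = t ∧ d.snd = s then (1 : ℝ) else 0)).sum

/-- `I` decomposes into path currents: `I` lies in the dissipation space, and
`I = ∑ γ, ξ γ • pathCurrent γ`, summed over all paths from `x` to `y`, for some real coefficients,
where the sum converges (unconditionally) in the norm of the dissipation space. -/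
def IsSumOfPathCurrents (N : ConductanceGraph V) (x y : V) (I : V → V → ℝ) : Prop :=
  N.FiniteDissipation I ∧
    ∃ ξ : N.graph.Walk x y → ℝ,
      Tendsto
        (fun F : Finset (N.graph.Walk x y) =>
          N.dissipation fun s t => I s t - ∑ γ ∈ F, ξ γ * N.pathCurrent γ s t)
        atTop (𝓝 0)

/-! ### The effective resistance of a finite connected network is well defined -/

theorem laplacian_eq_sum [Fintype V] (N : ConductanceGraph V) (v : V → ℝ) (x : V) :
    N.laplacian v x = ∑ y, N.c x y * (v x - v y) := tsum_fintype _

theorem sum_laplacian [Fintype V] (N : ConductanceGraph V) (v : V → ℝ) :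
    ∑ x, N.laplacian v x = 0 := by
  have h : ∑ x, N.laplacian v x = - ∑ x, N.laplacian v x := by
    simp only [laplacian_eq_sum]
    conv_lhs => rw [Finset.sum_comm]
    rw [← Finset.sum_neg_distrib]
    refine Finset.sum_congr rfl fun x _ => ?_
    rw [← Finset.sum_neg_distrib]
    refine Finset.sum_congr rfl fun y _ => ?_
    rw [N.symm y x]; ring
  linarith

theorem sum_mul_laplacian [Fintype V] (N : ConductanceGraph V) (v : V → ℝ) :
    2 * ∑ x, v x * N.laplacian v x = ∑ x, ∑ y, N.c x y * (v x - v y) ^ 2 := by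
  have h1 : ∑ x, v x * N.laplacian v x = ∑ x, ∑ y, v x * (N.c x y * (v x - v y)) := by
    simp only [laplacian_eq_sum, Finset.mul_sum]
  have h2 : ∑ x, v x * N.laplacian v x = ∑ x, ∑ y, v y * (N.c x y * (v y - v x)) := by
    rw [h1, Finset.sum_comm]
    refine Finset.sum_congr rfl fun x _ => Finset.sum_congr rfl fun y _ => ?_
    rw [N.symm y x]
  rw [two_mul]
  nth_rewrite 1 [h1]
  rw [h2, ← Finset.sum_add_distrib]
  refine Finset.sum_congr rfl fun x _ => ?_
  rw [← Finset.sum_add_distrib]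
  refine Finset.sum_congr rfl fun y _ => ?_
  ring

theorem eq_of_laplacian_eq_zero [Finite V] (N : ConductanceGraph V) (hN : N.graph.Connected)
    {v : V → ℝ} (hv : ∀ z, N.laplacian v z = 0) (x y : V) : v x = v y := by
  have := Fintype.ofFinite V
  have h0 : ∑ x, ∑ y, N.c x y * (v x - v y) ^ 2 = 0 := by
    rw [← sum_mul_laplacian]; simp [hv]
  have hnn : ∀ a b, 0 ≤ N.c a b * (v a - v b) ^ 2 :=
    fun a b => mul_nonneg (N.nonneg a b) (sq_nonneg _)
  have hadj : ∀ a b, N.graph.Adj a b → v a = v b := by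
    intro a b hab
    have h1 := (Finset.sum_eq_zero_iff_of_nonneg
      (fun x _ => Finset.sum_nonneg fun y _ => hnn x y)).1 h0 a (Finset.mem_univ a)
    have h2 := (Finset.sum_eq_zero_iff_of_nonneg (fun y _ => hnn a y)).1 h1 b (Finset.mem_univ b)
    rcases mul_eq_zero.1 h2 with h | h
    · exact absurd h (ne_of_gt hab)
    · have := pow_eq_zero_iff (two_ne_zero) |>.1 h
      linarith
  obtain ⟨w⟩ := hN.preconnected x y
  induction w with
  | nil => rfl
  | cons h _ ih => exact (hadj _ _ h).trans ih

theorem effectiveResistance_eq [Finite V] (N : ConductanceGraph V) (hN : N.graph.Connected)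
    {x y : V} {v : V → ℝ} (hv : ∀ z, N.laplacian v z = delta x z - delta y z) :
    N.effectiveResistance x y = v x - v y := by
  have := Fintype.ofFinite V
  have h : ∃ v : V → ℝ, ∀ z, N.laplacian v z = delta x z - delta y z := ⟨v, hv⟩
  rw [effectiveResistance, dif_pos h]
  obtain ⟨w, hw, hwe⟩ : ∃ w : V → ℝ, (∀ z, N.laplacian w z = delta x z - delta y z) ∧
      w = h.choose := ⟨_, h.choose_spec, rfl⟩
  rw [← hwe]
  have h0 : ∀ z, N.laplacian (fun s => w s - v s) z = 0 := by
    intro z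
    have e : N.laplacian (fun s => w s - v s) z = N.laplacian w z - N.laplacian v z := by
      simp only [laplacian_eq_sum, ← Finset.sum_sub_distrib]
      exact Finset.sum_congr rfl fun y _ => by ring
    rw [e, hw z, hv z, sub_self]
  have h1 : w x - v x = w y - v y := N.eq_of_laplacian_eq_zero hN h0 x y
  linarith

theorem exists_potential [Finite V] (N : ConductanceGraph V) (hN : N.graph.Connected) (x y : V) :
    ∃ v : V → ℝ, ∀ z, N.laplacian v z = delta x z - delta y z := by
  classical
  have := Fintype.ofFinite V
  let L : (V → ℝ) →ₗ[ℝ] (V → ℝ) :=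
    { toFun := N.laplacian
      map_add' := fun u v => by
        funext z
        simp only [laplacian_eq_sum, Pi.add_apply, ← Finset.sum_add_distrib]
        exact Finset.sum_congr rfl fun y _ => by ring
      map_smul' := fun a u => by
        funext z
        simp only [laplacian_eq_sum, Pi.smul_apply, smul_eq_mul, RingHom.id_apply, Finset.mul_sum]
        exact Finset.sum_congr rfl fun y _ => by ring }
  let S : (V → ℝ) →ₗ[ℝ] ℝ := ∑ z, LinearMap.proj z
  have hS : ∀ u, S u = ∑ z, u z := fun u => by simp [S]
  have hle : LinearMap.range L ≤ LinearMap.ker S := by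
    rintro _ ⟨u, rfl⟩
    rw [LinearMap.mem_ker, hS]
    exact N.sum_laplacian u
  have hker : LinearMap.ker L ≤ Submodule.span ℝ {fun _ => (1 : ℝ)} := by
    intro u hu
    rw [Submodule.mem_span_singleton]
    refine ⟨u x, ?_⟩
    funext z
    have hz : ∀ z, N.laplacian u z = 0 := fun z => congrFun (LinearMap.mem_ker.1 hu) z
    simp [N.eq_of_laplacian_eq_zero hN hz x z]
  have hk1 : Module.finrank ℝ (LinearMap.ker L) ≤ 1 :=
    (Submodule.finrank_mono hker).trans
      ((finrank_span_le_card _).trans (by simp))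
  have hr := LinearMap.finrank_range_add_finrank_ker L
  have hs := LinearMap.finrank_range_add_finrank_ker S
  have hsr : LinearMap.range S = ⊤ := by
    rw [LinearMap.range_eq_top]
    intro a
    exact ⟨Pi.single x a, by simp [hS]⟩
  rw [hsr, finrank_top, Module.finrank_self] at hs
  have heq : LinearMap.range L = LinearMap.ker S :=
    Submodule.eq_of_le_of_finrank_le hle (by omega)
  have hmem : (fun z => delta x z - delta y z) ∈ LinearMap.range L := by
    rw [heq, LinearMap.mem_ker, hS]
    simp [delta]
  obtain ⟨v, hv⟩ := hmem
  exact ⟨v, fun z => congrFun hv z⟩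

end ConductanceGraph

namespace ConductanceGraph

variable {V : Type*}

/-! ### The Hilbert space of currents

A current `I` of finite dissipation is represented by the square summable function `I / √c`. -/

/-! A current `I` becomes the vector `I / √c` in a Hilbert space whose squared norm is `2 D(I)`,
since both orientations of an edge are counted. A function `u` of finite energy gives a vector `grad
u`, with inner product `2 E`, and a path `γ` gives `walkVec γ`. Telescoping yields `⟨walkVec γ, grad
u⟩ = 2 (u x - u y)`, and the gradients are exactly the vectors orthogonal to all closed walks at `x`
(`exists_grad_eq`). Hence the projection of `walkVec γ` onto this complement is `grad v`, where
`E(v, u) = u x - u y` for all `u` (`exists_potential_of_walk`). Every quantity in the theorem equals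
`E(v)`.

For the free resistance, the unit flow of a finite subnetwork, extended by zero, pairs with anything
that is a gradient there. Cauchy–Schwarz against `grad v` gives `E(v) ≤ R_F`; against `γ - r C`,
with walks inside `F`, it gives `R_F ≤ ½ ‖γ - r C‖²`. The latter bounds come arbitrarily close to `½
‖grad v‖² = E(v)`, since `γ - grad v` is a limit of rational multiples of closed walks
(`Exhaustion.tendsto_resistanceIn`).

For the dissipation, `grad v` is `γ` plus a limit of cycles, which can be written as a series of
paths (`exists_hasSum_walkVec`). Conversely, the coefficients of a decomposable unit flow sum to `1`
if `x ≠ y`, so its pairing with `grad v` is forced (`inner_grad_of_flow`). The variational formulas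
are Cauchy–Schwarz, with equality at multiples of `v`. -/

theorem memℓp_two_iff {ι : Type*} {f : ι → ℝ} :
    Memℓp f 2 ↔ Summable fun i => f i ^ 2 := by
  rw [memℓp_gen_iff (by norm_num)]
  simp

theorem lp_hasSum_mul {ι : Type*} (f g : lp (fun _ : ι => ℝ) 2) :
    HasSum (fun i => f i * g i) (inner ℝ f g) := by
  have h := lp.hasSum_inner (𝕜 := ℝ) f g
  simpa [mul_comm] using h

/-- The square summable antisymmetric functions supported on the edges. -/
def currentSpace (N : ConductanceGraph V) : Submodule ℝ (lp (fun _ : V × V => ℝ) 2) where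
  carrier := {f | (∀ s t, f (s, t) = - f (t, s)) ∧ ∀ s t, N.c s t = 0 → f (s, t) = 0}
  add_mem' := by
    rintro f g ⟨hf, hf'⟩ ⟨hg, hg'⟩
    refine ⟨fun s t => ?_, fun s t h => ?_⟩
    · simp only [lp.coeFn_add, Pi.add_apply, hf s t, hg s t]; ring
    · simp only [lp.coeFn_add, Pi.add_apply, hf' s t h, hg' s t h, add_zero]
  zero_mem' := by simp
  smul_mem' := by
    rintro a f ⟨hf, hf'⟩
    refine ⟨fun s t => ?_, fun s t h => ?_⟩
    · simp only [lp.coeFn_smul, Pi.smul_apply, hf s t, smul_neg]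
    · simp only [lp.coeFn_smul, Pi.smul_apply, hf' s t h, smul_zero]

theorem isClosed_currentSpace (N : ConductanceGraph V) :
    IsClosed (N.currentSpace : Set (lp (fun _ : V × V => ℝ) 2)) := by
  have hc : ∀ p : V × V, Continuous fun f : lp (fun _ : V × V => ℝ) 2 => f p := fun p =>
    (continuous_apply p).comp (lp.uniformContinuous_coe (p := 2)).continuous
  have : (N.currentSpace : Set (lp (fun _ : V × V => ℝ) 2)) =
      (⋂ s, ⋂ t, {f | f (s, t) = - f (t, s)}) ∩
        ⋂ s, ⋂ t, ⋂ (_ : N.c s t = 0), {f | f (s, t) = 0} := by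
    ext f
    simp [currentSpace]
  rw [this]
  refine IsClosed.inter ?_ ?_
  · exact isClosed_iInter fun s => isClosed_iInter fun t =>
      isClosed_eq (hc _) (hc _).neg
  · exact isClosed_iInter fun s => isClosed_iInter fun t => isClosed_iInter fun _ =>
      isClosed_eq (hc _) continuous_const

instance (N : ConductanceGraph V) : CompleteSpace N.currentSpace :=
  N.isClosed_currentSpace.completeSpace_coe

theorem currentSpace_antisymm (N : ConductanceGraph V) (f : N.currentSpace) (s t : V) :
    f.1 (s, t) = - f.1 (t, s) := f.2.1 s t

theorem hasSum_inner_currentSpace (N : ConductanceGraph V) (f g : N.currentSpace) :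
    HasSum (fun p => f.1 p * g.1 p) (inner ℝ f g) := lp_hasSum_mul f.1 g.1

theorem hasSum_norm_sq_currentSpace (N : ConductanceGraph V) (f : N.currentSpace) :
    HasSum (fun p => f.1 p ^ 2) (‖f‖ ^ 2) := by
  have h := N.hasSum_inner_currentSpace f f
  rw [real_inner_self_eq_norm_sq] at h
  simpa [pow_two] using h

/-! ### Functions of finite energy -/

theorem sqrt_c_mul_self (N : ConductanceGraph V) (s t : V) : √(N.c s t) * √(N.c s t) = N.c s t :=
  Real.mul_self_sqrt (N.nonneg s t)

theorem sqrt_c_sq (N : ConductanceGraph V) (s t : V) : √(N.c s t) ^ 2 = N.c s t :=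
  Real.sq_sqrt (N.nonneg s t)

theorem sqrt_c_pos (N : ConductanceGraph V) {s t : V} (h : N.graph.Adj s t) : 0 < √(N.c s t) :=
  Real.sqrt_pos.2 h

/-- The element of the space of currents given by a function of finite energy. -/
noncomputable def grad (N : ConductanceGraph V) (u : V → ℝ) (hu : N.FiniteEnergy u) :
    N.currentSpace :=
  ⟨⟨fun p => √(N.c p.1 p.2) * (u p.1 - u p.2), memℓp_two_iff.2 <| by
      simp only [mul_pow, sqrt_c_sq]
      exact hu⟩,
    fun s t => by
      change √(N.c s t) * (u s - u t) = -(√(N.c t s) * (u t - u s))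
      rw [N.symm t s]; ring,
    fun s t h => by
      change √(N.c s t) * (u s - u t) = 0
      rw [h]; simp⟩

theorem grad_apply (N : ConductanceGraph V) (u : V → ℝ) (hu : N.FiniteEnergy u) (s t : V) :
    (N.grad u hu).1 (s, t) = √(N.c s t) * (u s - u t) := rfl

theorem inner_grad (N : ConductanceGraph V) {u v : V → ℝ} (hu : N.FiniteEnergy u)
    (hv : N.FiniteEnergy v) : inner ℝ (N.grad u hu) (N.grad v hv) = 2 * N.energy u v := by
  rw [← (N.hasSum_inner_currentSpace _ _).tsum_eq, energy, ← mul_assoc]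
  rw [show (2 : ℝ) * (1 / 2) = 1 by norm_num, one_mul]
  refine tsum_congr fun p => ?_
  change √(N.c p.1 p.2) * (u p.1 - u p.2) * (√(N.c p.1 p.2) * (v p.1 - v p.2)) = _
  linear_combination (u p.1 - u p.2) * (v p.1 - v p.2) * N.sqrt_c_mul_self p.1 p.2

theorem norm_grad_sq (N : ConductanceGraph V) {u : V → ℝ} (hu : N.FiniteEnergy u) :
    ‖N.grad u hu‖ ^ 2 = 2 * N.energy u u := by
  rw [← inner_grad N hu hu, real_inner_self_eq_norm_sq]

/-- Transfers closure under linear operations from the current space to functions of finite energy.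
-/
theorem finiteEnergy_of_grad (N : ConductanceGraph V) (f : N.currentSpace) {u : V → ℝ}
    (h : ∀ s t, f.1 (s, t) = √(N.c s t) * (u s - u t)) : N.FiniteEnergy u := by
  have := (N.hasSum_norm_sq_currentSpace f).summable
  refine this.congr fun p => ?_
  rw [h p.1 p.2, mul_pow, sqrt_c_sq]

theorem finiteEnergy_smul (N : ConductanceGraph V) {u : V → ℝ} (hu : N.FiniteEnergy u) (a : ℝ) :
    N.FiniteEnergy (a • u) :=
  N.finiteEnergy_of_grad (a • N.grad u hu) fun s t => by
    simp [grad_apply]; ring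

theorem finiteEnergy_sub (N : ConductanceGraph V) {u v : V → ℝ} (hu : N.FiniteEnergy u)
    (hv : N.FiniteEnergy v) : N.FiniteEnergy (u - v) :=
  N.finiteEnergy_of_grad (N.grad u hu - N.grad v hv) fun s t => by
    simp [grad_apply]; ring

theorem grad_sub (N : ConductanceGraph V) {u v : V → ℝ} (hu : N.FiniteEnergy u)
    (hv : N.FiniteEnergy v) :
    N.grad (u - v) (N.finiteEnergy_sub hu hv) = N.grad u hu - N.grad v hv := by
  ext ⟨s, t⟩
  simp [grad_apply]; ring

theorem energy_smul_smul (N : ConductanceGraph V) (u : V → ℝ) (a : ℝ) :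
    N.energy (a • u) (a • u) = a ^ 2 * N.energy u u := by
  rw [energy, energy, mul_left_comm, ← tsum_mul_left (a := a ^ 2)]
  refine congrArg _ (tsum_congr fun p => ?_)
  simp only [Pi.smul_apply, smul_eq_mul]; ring

theorem energy_comm (N : ConductanceGraph V) (u v : V → ℝ) : N.energy u v = N.energy v u := by
  rw [energy, energy]
  exact congrArg _ (tsum_congr fun p => by ring)

theorem energy_nonneg (N : ConductanceGraph V) (u : V → ℝ) : 0 ≤ N.energy u u := by
  refine mul_nonneg (by norm_num) (tsum_nonneg fun p => ?_)
  rw [mul_assoc]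
  exact mul_nonneg (N.nonneg _ _) (mul_self_nonneg _)

theorem energy_sq_le (N : ConductanceGraph V) {u v : V → ℝ} (hu : N.FiniteEnergy u)
    (hv : N.FiniteEnergy v) : N.energy u v ^ 2 ≤ N.energy u u * N.energy v v := by
  have h := real_inner_mul_inner_self_le (N.grad u hu) (N.grad v hv)
  simp only [inner_grad] at h
  nlinarith

theorem energy_sub_left (N : ConductanceGraph V) {u v w : V → ℝ} (hu : N.FiniteEnergy u)
    (hv : N.FiniteEnergy v) (hw : N.FiniteEnergy w) :
    N.energy (u - v) w = N.energy u w - N.energy v w := by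
  have h := inner_sub_left (𝕜 := ℝ) (N.grad u hu) (N.grad v hv) (N.grad w hw)
  rw [← grad_sub, inner_grad, inner_grad, inner_grad] at h
  linarith

theorem eq_of_energy_eq_zero (N : ConductanceGraph V) (hN : N.graph.Connected) {u : V → ℝ}
    (hu : N.FiniteEnergy u) (h : N.energy u u = 0) (s t : V) : u s = u t := by
  have h0 : N.grad u hu = 0 := by
    rw [← norm_eq_zero, ← pow_eq_zero_iff two_ne_zero, norm_grad_sq, h, mul_zero]
  obtain ⟨w⟩ := hN.preconnected s t
  induction w with
  | nil => rfl
  | @cons a b _ hab _ ih =>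
    have h1 : √(N.c a b) * (u a - u b) = 0 := by rw [← N.grad_apply u hu, h0]; rfl
    have := (mul_eq_zero.1 h1).resolve_left (N.sqrt_c_pos hab).ne'
    linarith

/-! ### Vectors of walks -/

open Classical in
/-- A multiple of the difference of the standard unit vectors at `(a, b)` and `(b, a)`. -/
noncomputable def pairVec (r : ℝ) (a b : V) : lp (fun _ : V × V => ℝ) 2 :=
  r • (lp.single 2 (a, b) (1 : ℝ) - lp.single 2 (b, a) (1 : ℝ))

open Classical in
theorem pairVec_apply (r : ℝ) (a b s t : V) :
    pairVec r a b (s, t) =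
      r * ((if a = s ∧ b = t then 1 else 0) - (if a = t ∧ b = s then 1 else 0)) := by
  change r * ((Pi.single (a, b) (1 : ℝ) : V × V → ℝ) (s, t) -
    (Pi.single (b, a) (1 : ℝ) : V × V → ℝ) (s, t)) = _
  have h1 : (s, t) = (a, b) ↔ a = s ∧ b = t := by
    rw [Prod.mk.injEq, eq_comm, @eq_comm _ t]
  have h2 : (s, t) = (b, a) ↔ a = t ∧ b = s := by
    rw [Prod.mk.injEq, eq_comm, @eq_comm _ t, and_comm]
  rw [Pi.single_apply, Pi.single_apply, if_congr h1 rfl rfl, if_congr h2 rfl rfl]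

theorem inner_pairVec (r : ℝ) (a b : V) (f : lp (fun _ : V × V => ℝ) 2) :
    inner ℝ (pairVec r a b) f = r * (f (a, b) - f (b, a)) := by
  classical
  rw [pairVec, inner_smul_left, inner_sub_left, lp.inner_single_left, lp.inner_single_left]
  simp

/-- The unit current along a dart. -/
noncomputable def dartVec (N : ConductanceGraph V) (d : N.graph.Dart) : N.currentSpace :=
  ⟨pairVec (√(N.c d.fst d.snd))⁻¹ d.fst d.snd,
    fun s t => by
      rw [pairVec_apply, pairVec_apply]
      ring,
    fun s t h => by
      have h1 : ¬ (d.fst = s ∧ d.snd = t) := by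
        rintro ⟨rfl, rfl⟩; exact (ne_of_gt d.adj : N.c _ _ ≠ 0) h
      have h2 : ¬ (d.fst = t ∧ d.snd = s) := by
        rintro ⟨rfl, rfl⟩; exact (ne_of_gt d.symm.adj : N.c _ _ ≠ 0) h
      rw [pairVec_apply, if_neg h1, if_neg h2, sub_self, mul_zero]⟩

theorem inner_dartVec (N : ConductanceGraph V) (d : N.graph.Dart) (f : N.currentSpace) :
    inner ℝ (N.dartVec d) f = 2 * ((√(N.c d.fst d.snd))⁻¹ * f.1 (d.fst, d.snd)) := by
  change inner ℝ (N.dartVec d).1 f.1 = _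
  rw [dartVec, inner_pairVec, N.currentSpace_antisymm f d.snd d.fst]
  ring

open Classical in
theorem dartVec_apply (N : ConductanceGraph V) (d : N.graph.Dart) (s t : V) :
    (N.dartVec d).1 (s, t) = (√(N.c s t))⁻¹ *
      ((if d.fst = s ∧ d.snd = t then (1 : ℝ) else 0) -
        (if d.fst = t ∧ d.snd = s then (1 : ℝ) else 0)) := by
  rw [dartVec, pairVec_apply]
  by_cases h1 : d.fst = s ∧ d.snd = t
  · rw [h1.1, h1.2]
  · by_cases h2 : d.fst = t ∧ d.snd = s
    · rw [h2.1, h2.2, N.symm t s]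
    · rw [if_neg h1, if_neg h2, sub_self, mul_zero, mul_zero]

theorem dartVec_symm (N : ConductanceGraph V) (d : N.graph.Dart) :
    N.dartVec d.symm = - N.dartVec d := by
  classical
  ext ⟨s, t⟩
  change _ = -(N.dartVec d).1 (s, t)
  rw [dartVec_apply, dartVec_apply]
  simp only [SimpleGraph.Dart.symm, Prod.fst_swap, Prod.snd_swap, and_comm]
  ring

/-- The vector of the path current of a walk. -/
noncomputable def walkVec (N : ConductanceGraph V) {x y : V} (γ : N.graph.Walk x y) :
    N.currentSpace := (γ.darts.map N.dartVec).sum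

theorem walkVec_nil (N : ConductanceGraph V) (x : V) :
    N.walkVec (SimpleGraph.Walk.nil : N.graph.Walk x x) = 0 := by simp [walkVec]

theorem walkVec_cons (N : ConductanceGraph V) {x y z : V} (h : N.graph.Adj x y)
    (γ : N.graph.Walk y z) :
    N.walkVec (SimpleGraph.Walk.cons h γ) = N.dartVec ⟨(x, y), h⟩ + N.walkVec γ := by
  simp [walkVec]

theorem walkVec_append (N : ConductanceGraph V) {x y z : V} (γ : N.graph.Walk x y)
    (γ' : N.graph.Walk y z) : N.walkVec (γ.append γ') = N.walkVec γ + N.walkVec γ' := by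
  simp [walkVec]

theorem walkVec_reverse (N : ConductanceGraph V) {x y : V} (γ : N.graph.Walk x y) :
    N.walkVec γ.reverse = - N.walkVec γ := by
  have : N.dartVec ∘ SimpleGraph.Dart.symm = fun d => - N.dartVec d :=
    funext fun d => N.dartVec_symm d
  rw [walkVec, walkVec, SimpleGraph.Walk.darts_reverse, List.map_reverse, List.sum_reverse,
    List.map_map, this]
  induction γ.darts with
  | nil => simp
  | cons d l ih => simp [ih]; abel

theorem walkVec_apply (N : ConductanceGraph V) {x y : V} (γ : N.graph.Walk x y) (s t : V) :
    (N.walkVec γ).1 (s, t) = (√(N.c s t))⁻¹ * N.pathCurrent γ s t := by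
  classical
  rw [walkVec, pathCurrent]
  induction γ.darts with
  | nil => simp
  | cons d l ih =>
    simp only [List.map_cons, List.sum_cons, Submodule.coe_add, lp.coeFn_add, Pi.add_apply, ih,
      dartVec_apply]
    ring

/-- The sum telescopes; the factor `2` comes from the two orientations of each edge. The gradient
condition is imposed only along `γ` because flows of finite subnetworks are gradients only inside
the subnetwork. -/
theorem inner_walkVec (N : ConductanceGraph V) {x y : V} (γ : N.graph.Walk x y)
    (f : N.currentSpace) (u : V → ℝ)
    (h : ∀ d ∈ γ.darts, f.1 (d.fst, d.snd) = √(N.c d.fst d.snd) * (u d.fst - u d.snd)) :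
    inner ℝ (N.walkVec γ) f = 2 * (u x - u y) := by
  induction γ with
  | nil => simp [walkVec_nil]
  | cons hab γ ih =>
    rw [SimpleGraph.Walk.darts_cons] at h
    rw [walkVec_cons, inner_add_left, ih fun d hd => h d (List.mem_cons_of_mem _ hd),
      inner_dartVec, h _ List.mem_cons_self]
    have := (N.sqrt_c_pos hab).ne'
    field_simp
    ring

theorem inner_walkVec_grad (N : ConductanceGraph V) {x y : V} (γ : N.graph.Walk x y)
    {u : V → ℝ} (hu : N.FiniteEnergy u) :
    inner ℝ (N.walkVec γ) (N.grad u hu) = 2 * (u x - u y) :=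
  N.inner_walkVec γ _ u fun _ _ => rfl

/-! ### Cycles and potentials -/

/-- Integrating `g` along a chosen path from `s` to `x` defines a potential. Its increment over an
edge `s t` is right because `g` annihilates the closed walk from `x` to `s`, across the edge, and
back to `x`. -/
theorem exists_grad_eq (N : ConductanceGraph V) (hN : N.graph.Connected) (x : V)
    (g : N.currentSpace) (hg : ∀ C : N.graph.Walk x x, inner ℝ (N.walkVec C) g = 0) :
    ∃ (u : V → ℝ) (hu : N.FiniteEnergy u), N.grad u hu = g := by
  let δ : ∀ s, N.graph.Walk s x := fun s => (hN.preconnected s x).some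
  let u : V → ℝ := fun s => 1 / 2 * inner ℝ (N.walkVec (δ s)) g
  have key : ∀ s t, g.1 (s, t) = √(N.c s t) * (u s - u t) := by
    intro s t
    by_cases h : N.graph.Adj s t
    · have h1 := hg ((δ s).reverse.append (SimpleGraph.Walk.cons h (δ t)))
      rw [walkVec_append, walkVec_reverse, walkVec_cons, inner_add_left, inner_add_left,
        inner_neg_left, inner_dartVec] at h1
      have h2 := (N.sqrt_c_pos h).ne'
      have h3 : u s - u t = (√(N.c s t))⁻¹ * g.1 (s, t) := by
        simp only [u]; linarith
      rw [h3]
      field_simp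
    · have h0 : N.c s t = 0 := le_antisymm (not_lt.1 h) (N.nonneg s t)
      rw [g.2.2 s t h0, h0]; simp
  refine ⟨u, N.finiteEnergy_of_grad g key, ?_⟩
  ext ⟨s, t⟩
  exact (key s t).symm

/-- The span of the vectors of the closed walks at `x`. -/
noncomputable def cycleSpace (N : ConductanceGraph V) (x : V) : Submodule ℝ N.currentSpace :=
  Submodule.span ℝ (Set.range fun C : N.graph.Walk x x => N.walkVec C)

theorem grad_mem_cycleSpace_orthogonal (N : ConductanceGraph V) (x : V) {u : V → ℝ}
    (hu : N.FiniteEnergy u) : N.grad u hu ∈ (N.cycleSpace x)ᗮ := by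
  rw [Submodule.mem_orthogonal]
  intro z hz
  induction hz using Submodule.span_induction with
  | mem z hz => obtain ⟨C, rfl⟩ := hz; rw [inner_walkVec_grad, sub_self, mul_zero]
  | zero => simp
  | add a b _ _ ha hb => rw [inner_add_left, ha, hb, add_zero]
  | smul r a _ ha => rw [inner_smul_left, ha, mul_zero]

theorem exists_mem_orthogonal_sub_mem_closure {E : Type*} [NormedAddCommGroup E]
    [InnerProductSpace ℝ E] [CompleteSpace E] (S : Submodule ℝ E) (w : E) :
    ∃ p ∈ Sᗮ, w - p ∈ S.topologicalClosure := by
  refine ⟨Sᗮ.starProjection w, Sᗮ.starProjection_apply_mem _, ?_⟩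
  rw [← Submodule.orthogonal_orthogonal_eq_closure]
  exact Sᗮ.sub_starProjection_mem_orthogonal _

theorem inner_eq_zero_of_mem_closure {E : Type*} [NormedAddCommGroup E]
    [InnerProductSpace ℝ E] [CompleteSpace E] {S : Submodule ℝ E} {z g : E}
    (hz : z ∈ S.topologicalClosure) (hg : g ∈ Sᗮ) : inner ℝ z g = 0 := by
  rw [← Submodule.orthogonal_orthogonal_eq_closure] at hz
  exact Submodule.inner_left_of_mem_orthogonal hg hz

/-- The part of `walkVec γ` removed by projection lies in the closed span of cycles, so it is
orthogonal to every gradient and the pairing with `grad u` is unchanged. -/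
theorem exists_potential_of_walk (N : ConductanceGraph V) (hN : N.graph.Connected) {x y : V}
    (γ : N.graph.Walk x y) :
    ∃ (v : V → ℝ) (hv : N.FiniteEnergy v),
      (∀ u, N.FiniteEnergy u → N.energy v u = u x - u y) ∧
      N.walkVec γ - N.grad v hv ∈ (N.cycleSpace x).topologicalClosure := by
  obtain ⟨p, hp, hpc⟩ := exists_mem_orthogonal_sub_mem_closure (N.cycleSpace x) (N.walkVec γ)
  obtain ⟨v, hv, rfl⟩ := N.exists_grad_eq hN x p fun C =>
    (Submodule.mem_orthogonal _ _).1 hp _ (Submodule.subset_span ⟨C, rfl⟩)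
  refine ⟨v, hv, fun u hu => ?_, hpc⟩
  have h := inner_eq_zero_of_mem_closure hpc (N.grad_mem_cycleSpace_orthogonal x hu)
  rw [inner_sub_left, inner_walkVec_grad, inner_grad] at h
  linarith

theorem exists_walkVec_eq_nsmul (N : ConductanceGraph V) {x : V} (C : N.graph.Walk x x) (n : ℕ) :
    ∃ C' : N.graph.Walk x x, N.walkVec C' = (n : ℝ) • N.walkVec C := by
  induction n with
  | zero => exact ⟨.nil, by simp [walkVec_nil]⟩
  | succ n ih =>
    obtain ⟨C', h⟩ := ih
    exact ⟨C'.append C, by rw [walkVec_append, h, Nat.cast_succ, add_smul, one_smul]⟩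

/-- The rational multiples of vectors of closed walks at `x`. -/
noncomputable def rationalCycles (N : ConductanceGraph V) (x : V) : AddSubgroup N.currentSpace where
  carrier := {z | ∃ n : ℕ, 0 < n ∧ ∃ C : N.graph.Walk x x, (n : ℝ) • z = N.walkVec C}
  zero_mem' := ⟨1, one_pos, .nil, by simp [walkVec_nil]⟩
  add_mem' := by
    rintro a b ⟨n, hn, C, hC⟩ ⟨m, hm, D, hD⟩
    obtain ⟨C', hC'⟩ := N.exists_walkVec_eq_nsmul C m
    obtain ⟨D', hD'⟩ := N.exists_walkVec_eq_nsmul D n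
    refine ⟨n * m, Nat.mul_pos hn hm, C'.append D', ?_⟩
    rw [walkVec_append, hC', hD', ← hC, ← hD, smul_smul, smul_smul, Nat.cast_mul, smul_add,
      mul_comm (m : ℝ)]
  neg_mem' := by
    rintro a ⟨n, hn, C, hC⟩
    exact ⟨n, hn, C.reverse, by rw [walkVec_reverse, ← hC, smul_neg]⟩

theorem rat_smul_mem_rationalCycles (N : ConductanceGraph V) {x : V} {z : N.currentSpace}
    (hz : z ∈ N.rationalCycles x) (q : ℚ) : (q : ℝ) • z ∈ N.rationalCycles x := by
  have h1 : ∀ n : ℕ, 0 < n → ((n : ℝ)⁻¹) • z ∈ N.rationalCycles x := by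
    intro n hn
    obtain ⟨m, hm, C, hC⟩ := hz
    refine ⟨n * m, Nat.mul_pos hn hm, C, ?_⟩
    have : (n : ℝ) ≠ 0 := by exact_mod_cast hn.ne'
    rw [← hC, smul_smul]
    congr 1
    push_cast
    field_simp
  have h2 := AddSubgroup.zsmul_mem _ (h1 q.den q.den_pos) q.num
  rw [← Int.cast_smul_eq_zsmul ℝ, smul_smul] at h2
  rwa [Rat.cast_def, div_eq_mul_inv]

/-- Real coefficients are limits of rational ones, so passing to single closed walks loses nothing
in the closure. -/
theorem cycleSpace_closure_subset (N : ConductanceGraph V) (x : V) :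
    ((N.cycleSpace x).topologicalClosure : Set N.currentSpace) ⊆
      closure (N.rationalCycles x : Set N.currentSpace) := by
  rw [Submodule.topologicalClosure_coe]
  refine closure_minimal (fun z hz => ?_) isClosed_closure
  rw [← AddSubgroup.topologicalClosure_coe]
  induction hz using Submodule.span_induction with
  | mem z hz =>
    obtain ⟨C, rfl⟩ := hz
    exact subset_closure ⟨1, one_pos, C, by simp⟩
  | zero => exact zero_mem _
  | add a b _ _ ha hb => exact add_mem ha hb
  | smul r a _ ha =>
    exact map_mem_closure₂ continuous_smul (Rat.denseRange_cast r) ha <| by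
      rintro _ ⟨q, rfl⟩ b hb
      exact N.rat_smul_mem_rationalCycles hb q

/-! ### Decomposition into path currents -/

/-- Different indices may name the same path; summability of `r` makes each collected coefficient a
convergent sum. -/
theorem exists_hasSum_smul_of_fibers {ι κ E : Type*} [NormedAddCommGroup E] [NormedSpace ℝ E]
    (w : κ → E) (k : ι → κ) {r : ι → ℝ} (hr : Summable r) {a : E}
    (h : HasSum (fun i => r i • w (k i)) a) : ∃ ξ : κ → ℝ, HasSum (fun j => ξ j • w j) a := by
  refine ⟨fun j => ∑' i : {i // k i = j}, r i, ?_⟩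
  rw [← (Equiv.sigmaFiberEquiv k).hasSum_iff] at h
  refine h.sigma fun j => ?_
  have h1 : HasSum (fun i : {i // k i = j} => r i • w j) ((∑' i : {i // k i = j}, r i) • w j) :=
    (hr.comp_injective Subtype.val_injective).hasSum.smul_const (w j)
  refine h1.congr_fun ?_
  rintro ⟨i, rfl⟩
  rfl

theorem exists_hasSum_smul_add_smul {κ E : Type*} [NormedAddCommGroup E] [NormedSpace ℝ E]
    (w : κ → E) {a : E} {ξ : κ → ℝ} (h : HasSum (fun j => ξ j • w j) a) (k : κ) (r : ℝ) :
    ∃ ξ : κ → ℝ, HasSum (fun j => ξ j • w j) (a + r • w k) := by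
  classical
  refine ⟨fun j => ξ j + if j = k then r else 0, ?_⟩
  refine (h.add (hasSum_ite_eq k (r • w k))).congr_fun fun j => ?_
  rw [add_smul]
  split_ifs with hj
  · rw [hj]
  · rw [zero_smul]

/-- The limit of cycles `f - γ` is expanded as `∑ rₙ Cₙ` with `∑ rₙ < ∞`. Prefixing each `Cₙ` to `γ`
turns cycles into paths from `x` to `y`, at the cost of an extra `(∑ rₙ) γ`, which converges and is
corrected by a single coefficient. -/
theorem exists_hasSum_walkVec (N : ConductanceGraph V) {x y : V} (γ : N.graph.Walk x y)
    (f : N.currentSpace) (hf : N.walkVec γ - f ∈ (N.cycleSpace x).topologicalClosure) :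
    ∃ ξ : N.graph.Walk x y → ℝ, HasSum (fun γ => ξ γ • N.walkVec γ) f := by
  classical
  have ha : f - N.walkVec γ ∈ closure (N.rationalCycles x : Set N.currentSpace) := by
    refine N.cycleSpace_closure_subset x ?_
    rw [← neg_sub]
    exact neg_mem hf
  obtain ⟨v, hv, hvm, -, hvb⟩ := controlled_sum_of_mem_closure ha
    (b := fun n : ℕ => (1 / 2 : ℝ) ^ n) fun n => by positivity
  have hgeo : Summable fun n : ℕ => (1 / 2 : ℝ) ^ n := summable_geometric_two
  have hvs : Summable v := by
    -- The norm bound on `v n` holds only for `n > 0`, so the initial term is dropped.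
    rw [← summable_nat_add_iff 1]
    exact Summable.of_norm_bounded ((summable_nat_add_iff 1).2 hgeo)
      fun n => (hvb (n + 1) n.succ_pos).le
  have hsum : HasSum v (f - N.walkVec γ) := by
    have := tendsto_nhds_unique ((tendsto_add_atTop_iff_nat 1).2 hvs.hasSum.tendsto_sum_nat) hv
    rw [← this]
    exact hvs.hasSum
  have hC : ∀ n, ∃ r : ℝ, 0 ≤ r ∧ r ≤ (1 / 2) ^ n ∧ ∃ C : N.graph.Walk x x,
      v n = r • N.walkVec C := by
    intro n
    obtain ⟨m, hm, C, hC⟩ := hvm n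
    obtain ⟨C', hC'⟩ := N.exists_walkVec_eq_nsmul C (2 ^ n)
    have hm' : (1 : ℝ) ≤ m := by exact_mod_cast hm
    -- Running `C` around `2 ^ n` times divides its coefficient by `2 ^ n`; this makes the
    -- coefficients summable whatever the norms of the cycles are.
    refine ⟨((1 / 2) ^ n) * (m : ℝ)⁻¹, by positivity, ?_, C', ?_⟩
    · exact mul_le_of_le_one_right (by positivity) (inv_le_one_of_one_le₀ hm')
    · rw [hC', ← hC, smul_smul, smul_smul]
      have : ((1 / 2) ^ n * (m : ℝ)⁻¹ * (2 ^ n : ℕ) * m) = 1 := by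
        push_cast
        rw [one_div, inv_pow]
        field_simp
      rw [this, one_smul]
  choose r hr0 hr C hvC using hC
  have hrs : Summable r := Summable.of_nonneg_of_le hr0 hr hgeo
  have h1 : HasSum (fun n => r n • N.walkVec ((C n).append γ))
      (f - N.walkVec γ + (∑' n, r n) • N.walkVec γ) := by
    have h := hsum.add (hrs.hasSum.smul_const (N.walkVec γ))
    refine h.congr_fun fun n => ?_
    rw [walkVec_append, smul_add, hvC n]
  obtain ⟨ξ, hξ⟩ := exists_hasSum_smul_of_fibers (fun γ => N.walkVec γ)
    (fun n => (C n).append γ) hrs h1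
  obtain ⟨ξ', hξ'⟩ := exists_hasSum_smul_add_smul (fun γ => N.walkVec γ) hξ γ (1 - ∑' n, r n)
  refine ⟨ξ', ?_⟩
  have h2 : f - N.walkVec γ + (∑' n, r n) • N.walkVec γ + (1 - ∑' n, r n) • N.walkVec γ = f := by
    rw [sub_smul, one_smul]
    abel
  rwa [h2] at hξ'

/-! ### Dissipation -/

theorem inv_c_mul_sq (N : ConductanceGraph V) (f : N.currentSpace) {J : V → V → ℝ}
    (h : ∀ s t, f.1 (s, t) = (√(N.c s t))⁻¹ * J s t) (p : V × V) :
    (N.c p.1 p.2)⁻¹ * J p.1 p.2 ^ 2 = f.1 p ^ 2 := by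
  rw [h p.1 p.2, mul_pow, inv_pow, sqrt_c_sq]

theorem finiteDissipation_of_vec (N : ConductanceGraph V) (f : N.currentSpace) {J : V → V → ℝ}
    (h : ∀ s t, f.1 (s, t) = (√(N.c s t))⁻¹ * J s t) : N.FiniteDissipation J :=
  (N.hasSum_norm_sq_currentSpace f).summable.congr fun p => (N.inv_c_mul_sq f h p).symm

theorem dissipation_of_vec (N : ConductanceGraph V) (f : N.currentSpace) {J : V → V → ℝ}
    (h : ∀ s t, f.1 (s, t) = (√(N.c s t))⁻¹ * J s t) :
    N.dissipation J = 1 / 2 * ‖f‖ ^ 2 := by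
  rw [dissipation, ← (N.hasSum_norm_sq_currentSpace f).tsum_eq]
  exact congrArg _ (tsum_congr fun p => N.inv_c_mul_sq f h p)

theorem exists_vec_of_current (N : ConductanceGraph V) {I : V → V → ℝ} (hI : N.IsCurrent I)
    (hD : N.FiniteDissipation I) :
    ∃ f : N.currentSpace, ∀ s t, f.1 (s, t) = (√(N.c s t))⁻¹ * I s t := by
  refine ⟨⟨⟨fun p => (√(N.c p.1 p.2))⁻¹ * I p.1 p.2, memℓp_two_iff.2 ?_⟩, fun s t => ?_,
    fun s t h => ?_⟩, fun s t => rfl⟩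
  · simp only [mul_pow, inv_pow, sqrt_c_sq]
    exact hD
  · change (√(N.c s t))⁻¹ * I s t = -((√(N.c t s))⁻¹ * I t s)
    rw [hI.1 s t, N.symm s t, mul_neg]
  · change (√(N.c s t))⁻¹ * I s t = 0
    rw [hI.2 s t h, mul_zero]

theorem sum_walkVec_apply (N : ConductanceGraph V) {x y : V} (ξ : N.graph.Walk x y → ℝ)
    (F : Finset (N.graph.Walk x y)) (s t : V) :
    (∑ γ ∈ F, ξ γ • N.walkVec γ : N.currentSpace).1 (s, t) =
      (√(N.c s t))⁻¹ * ∑ γ ∈ F, ξ γ * N.pathCurrent γ s t := by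
  classical
  induction F using Finset.induction_on with
  | empty => simp
  | insert γ F hγ ih =>
    rw [Finset.sum_insert hγ, Finset.sum_insert hγ, mul_add, ← ih]
    change ξ γ * (N.walkVec γ).1 (s, t) + _ = _
    rw [walkVec_apply]
    ring

theorem hasSum_iff_tendsto_norm_sq {ι E : Type*} [NormedAddCommGroup E] (g : ι → E) (a : E) :
    HasSum g a ↔ Tendsto (fun F : Finset ι => 1 / 2 * ‖a - ∑ i ∈ F, g i‖ ^ 2) atTop (𝓝 0) := by
  rw [HasSum, SummationFilter.unconditional_filter, tendsto_iff_norm_sub_tendsto_zero]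
  simp only [norm_sub_rev _ a]
  constructor
  · intro h
    have h' := (h.pow 2).const_mul (1 / 2 : ℝ)
    rwa [zero_pow two_ne_zero, mul_zero] at h'
  · intro h
    have h' := (h.const_mul 2).sqrt
    simp only [mul_zero, Real.sqrt_zero] at h'
    refine h'.congr fun F => ?_
    rw [← mul_assoc]
    norm_num

theorem tendsto_dissipation_iff_hasSum (N : ConductanceGraph V) {x y : V} (f : N.currentSpace)
    {I : V → V → ℝ} (h : ∀ s t, f.1 (s, t) = (√(N.c s t))⁻¹ * I s t)
    (ξ : N.graph.Walk x y → ℝ) :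
    Tendsto (fun F : Finset (N.graph.Walk x y) =>
      N.dissipation fun s t => I s t - ∑ γ ∈ F, ξ γ * N.pathCurrent γ s t) atTop (𝓝 0) ↔
    HasSum (fun γ => ξ γ • N.walkVec γ) f := by
  have h1 : ∀ F : Finset (N.graph.Walk x y),
      (N.dissipation fun s t => I s t - ∑ γ ∈ F, ξ γ * N.pathCurrent γ s t) =
        1 / 2 * ‖f - ∑ γ ∈ F, ξ γ • N.walkVec γ‖ ^ 2 := by
    intro F
    refine N.dissipation_of_vec _ fun s t => ?_
    change f.1 (s, t) - (∑ γ ∈ F, ξ γ • N.walkVec γ : N.currentSpace).1 (s, t) = _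
    rw [sum_walkVec_apply, h, mul_sub]
  simp only [h1]
  exact (hasSum_iff_tendsto_norm_sq _ _).symm

/-! ### Divergence -/

theorem delta_comm (s t : V) : delta s t = delta t s := by
  by_cases h : s = t
  · rw [h]
  · simp [delta, h, Ne.symm h]

theorem delta_self (s : V) : delta s s = 1 := by simp [delta]

theorem delta_of_ne {s t : V} (h : t ≠ s) : delta s t = 0 := by simp [delta, h]

theorem delta_sq (s t : V) : delta s t ^ 2 = delta s t := by
  by_cases h : t = s
  · rw [h, delta_self, one_pow]
  · rw [delta_of_ne h]; norm_num

theorem summable_c_mul_delta (N : ConductanceGraph V) (s : V) :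
    Summable fun p : V × V => N.c p.1 p.2 * delta s p.1 := by
  have hinj : Function.Injective (Prod.mk s : V → V × V) := Prod.mk_right_injective s
  rw [← hinj.summable_iff]
  · refine (N.summable s).congr fun t => ?_
    simp [delta_self]
  · rintro ⟨a, b⟩ hab
    have : a ≠ s := by rintro rfl; exact hab ⟨b, rfl⟩
    simp [delta_of_ne this]

theorem finiteEnergy_delta (N : ConductanceGraph V) (s : V) : N.FiniteEnergy (delta s) := by
  have h1 := N.summable_c_mul_delta s
  have h2 := (Equiv.prodComm V V).summable_iff.2 h1
  refine Summable.of_nonneg_of_le (fun p => mul_nonneg (N.nonneg _ _) (sq_nonneg _)) (fun p => ?_)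
    (h1.add h2)
  have h3 : (delta s p.1 - delta s p.2) ^ 2 ≤ delta s p.1 + delta s p.2 := by
    have h4 : ∀ t, 0 ≤ delta s t := fun t => by rw [← delta_sq]; positivity
    nlinarith [delta_sq s p.1, delta_sq s p.2, mul_nonneg (h4 p.1) (h4 p.2)]
  have h5 := mul_le_mul_of_nonneg_left h3 (N.nonneg p.1 p.2)
  simp only [Function.comp, Equiv.prodComm_apply, Prod.fst_swap, Prod.snd_swap, N.symm p.2 p.1]
  linarith

/-- The net outflow at `s` is a pairing with `grad (delta s)`. The vector `e` below keeps only the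
pairs starting at `s`; by antisymmetry of `f`, those ending at `s` contribute equally. -/
theorem hasSum_divergence (N : ConductanceGraph V) (s : V) (f : N.currentSpace) :
    HasSum (fun t => √(N.c s t) * f.1 (s, t))
      (1 / 2 * inner ℝ (N.grad (delta s) (N.finiteEnergy_delta s)) f) := by
  let e : lp (fun _ : V × V => ℝ) 2 := ⟨fun p => √(N.c p.1 p.2) * delta s p.1,
    memℓp_two_iff.2 <| by
      simp only [mul_pow, sqrt_c_sq, delta_sq]
      exact N.summable_c_mul_delta s⟩
  have h1 : HasSum (fun p : V × V => √(N.c p.1 p.2) * delta s p.1 * f.1 p) (inner ℝ e f.1) :=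
    lp_hasSum_mul e f.1
  have h2 := ((Equiv.prodComm V V).hasSum_iff.2 h1).neg
  have h3 : HasSum (fun p : V × V => √(N.c p.1 p.2) * (delta s p.1 - delta s p.2) * f.1 p)
      (inner ℝ e f.1 - - inner ℝ e f.1) := by
    refine (h1.sub h2).congr_fun ?_
    rintro ⟨a, b⟩
    simp only [Function.comp, Equiv.prodComm_apply, Prod.swap_prod_mk,
      N.currentSpace_antisymm f b a, N.symm b a]
    ring
  have h4 := h3.unique (N.hasSum_inner_currentSpace (N.grad (delta s) (N.finiteEnergy_delta s)) f)
  rw [← h4, show 1 / 2 * (inner ℝ e f.1 - - inner ℝ e f.1) = inner ℝ e f.1 by ring]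
  have hinj : Function.Injective (Prod.mk s : V → V × V) := Prod.mk_right_injective s
  rw [← hinj.hasSum_iff] at h1
  · refine h1.congr_fun fun t => ?_
    simp [delta_self]
  · rintro ⟨a, b⟩ hab
    have : a ≠ s := by rintro rfl; exact hab ⟨b, rfl⟩
    simp [delta_of_ne this]

/-! ### Finite full subnetworks -/

theorem exists_finset_potential (N : ConductanceGraph V) {F : Finset V}
    (hF : (N.full (F : Set V)).graph.Connected) {x y : V} (hx : x ∈ F) (hy : y ∈ F) :
    ∃ w : V → ℝ, N.resistanceIn (F : Set V) x y = w x - w y ∧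
      ∀ s ∈ F, ∑ t ∈ F, N.c s t * (w s - w t) = delta x s - delta y s := by
  classical
  obtain ⟨v, hv⟩ := (N.full (F : Set V)).exists_potential hF ⟨x, hx⟩ ⟨y, hy⟩
  have hvw : ∀ s (hs : s ∈ F), (fun s => if h : s ∈ F then v ⟨s, h⟩ else 0) s = v ⟨s, hs⟩ :=
    fun s hs => dif_pos hs
  refine ⟨fun s => if h : s ∈ F then v ⟨s, h⟩ else 0, ?_, fun s hs => ?_⟩
  · rw [resistanceIn, dif_pos ⟨hx, hy⟩, effectiveResistance_eq _ hF hv, hvw x hx, hvw y hy]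
  · have h := hv ⟨s, hs⟩
    have e : ∀ z (hz : z ∈ F), (delta (⟨z, hz⟩ : (F : Set V)) ⟨s, hs⟩ : ℝ) = delta z s := by
      intro z hz
      simp only [delta, Subtype.mk.injEq]
    rw [e, e, laplacian_eq_sum] at h
    rw [← h, ← Finset.sum_coe_sort F]
    refine Finset.sum_congr rfl fun t _ => ?_
    rw [hvw s hs, hvw t t.2]
    rfl

/-- Summation by parts over `F`. -/
theorem sum_sum_eq_of_potential (N : ConductanceGraph V) {F : Finset V} {x y : V} (hx : x ∈ F)
    (hy : y ∈ F) {w : V → ℝ}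
    (hw : ∀ s ∈ F, ∑ t ∈ F, N.c s t * (w s - w t) = delta x s - delta y s) (u : V → ℝ) :
    ∑ s ∈ F, ∑ t ∈ F, N.c s t * (w s - w t) * (u s - u t) = 2 * (u x - u y) := by
  classical
  have h1 : ∑ s ∈ F, ∑ t ∈ F, N.c s t * (w s - w t) * u s = u x - u y := by
    have : ∀ s ∈ F, ∑ t ∈ F, N.c s t * (w s - w t) * u s =
        (if s = x then u s else 0) - (if s = y then u s else 0) := by
      intro s hs
      rw [← Finset.sum_mul, hw s hs]
      simp only [delta, sub_mul, ite_mul, one_mul, zero_mul]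
    rw [Finset.sum_congr rfl this, Finset.sum_sub_distrib, Finset.sum_ite_eq' F x,
      Finset.sum_ite_eq' F y, if_pos hx, if_pos hy]
  have h2 : ∑ s ∈ F, ∑ t ∈ F, N.c s t * (w s - w t) * u t = -(u x - u y) := by
    rw [← h1, Finset.sum_comm, ← Finset.sum_neg_distrib]
    refine Finset.sum_congr rfl fun s _ => ?_
    rw [← Finset.sum_neg_distrib]
    refine Finset.sum_congr rfl fun t _ => ?_
    rw [N.symm t s]; ring
  simp only [mul_sub, Finset.sum_sub_distrib] at h1 h2 ⊢
  linarith

/-- The unit current flow in a finite full subnetwork, as a vector of the whole network. -/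
theorem exists_finset_flow (N : ConductanceGraph V) {F : Finset V}
    (hF : (N.full (F : Set V)).graph.Connected) {x y : V} (hx : x ∈ F) (hy : y ∈ F) :
    ∃ (w : V → ℝ) (f : N.currentSpace), N.resistanceIn (F : Set V) x y = w x - w y ∧
      (∀ s ∈ F, ∀ t ∈ F, f.1 (s, t) = √(N.c s t) * (w s - w t)) ∧
      ∀ (g : N.currentSpace) (u : V → ℝ),
        (∀ s ∈ F, ∀ t ∈ F, g.1 (s, t) = √(N.c s t) * (u s - u t)) →
        inner ℝ f g = 2 * (u x - u y) := by
  classical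
  obtain ⟨w, hR, hw⟩ := N.exists_finset_potential hF hx hy
  let φ : V × V → ℝ := fun p => if p ∈ F ×ˢ F then √(N.c p.1 p.2) * (w p.1 - w p.2) else 0
  have hφ : ∀ p ∉ F ×ˢ F, φ p = 0 := fun p hp => if_neg hp
  have hφ' : ∀ s ∈ F, ∀ t ∈ F, φ (s, t) = √(N.c s t) * (w s - w t) := fun s hs t ht =>
    if_pos (Finset.mk_mem_product hs ht)
  have hmem : Memℓp φ 2 := memℓp_two_iff.2 <| summable_of_ne_finset_zero (s := F ×ˢ F)
    fun p hp => by rw [hφ p hp]; norm_num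
  refine ⟨w, ⟨⟨φ, hmem⟩, fun s t => ?_, fun s t h => ?_⟩, hR, hφ', fun g u hg => ?_⟩
  · change φ (s, t) = - φ (t, s)
    by_cases h : s ∈ F ∧ t ∈ F
    · rw [hφ' s h.1 t h.2, hφ' t h.2 s h.1, N.symm t s]; ring
    · rw [hφ _ (by simpa using h), hφ _ (by simpa [and_comm] using h), neg_zero]
  · change φ (s, t) = 0
    by_cases h' : s ∈ F ∧ t ∈ F
    · rw [hφ' s h'.1 t h'.2, h]; simp
    · rw [hφ _ (by simpa using h')]
  · refine (N.hasSum_inner_currentSpace _ g).unique ?_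
    have h1 : HasSum (fun p => φ p * g.1 p) (∑ p ∈ F ×ˢ F, φ p * g.1 p) :=
      hasSum_sum_of_ne_finset_zero fun p hp => by rw [hφ p hp, zero_mul]
    rw [← N.sum_sum_eq_of_potential hx hy hw u]
    rw [Finset.sum_product] at h1
    convert h1 using 1
    refine Finset.sum_congr rfl fun s hs => Finset.sum_congr rfl fun t ht => ?_
    rw [hφ' s hs t ht, hg s hs t ht]
    linear_combination -(w s - w t) * (u s - u t) * N.sqrt_c_mul_self s t

/-- Cauchy–Schwarz between the flow of the subnetwork, of squared norm `2 R`, and `grad u`. -/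
theorem sq_sub_le_resistanceIn_mul_energy (N : ConductanceGraph V) {F : Finset V}
    (hF : (N.full (F : Set V)).graph.Connected) {x y : V} (hx : x ∈ F) (hy : y ∈ F) {u : V → ℝ}
    (hu : N.FiniteEnergy u) :
    (u x - u y) ^ 2 ≤ N.resistanceIn (F : Set V) x y * N.energy u u := by
  obtain ⟨w, f, hR, hfw, hf⟩ := N.exists_finset_flow hF hx hy
  have h := real_inner_mul_inner_self_le f (N.grad u hu)
  rw [hf f w hfw, hf (N.grad u hu) u fun _ _ _ _ => rfl, inner_grad, ← hR] at h
  nlinarith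

/-- Thomson's principle: `γ - r C` is a competing unit flow inside `F`, and its pairing with the
potential flow is the squared norm `2 R` of the latter. -/
theorem resistanceIn_le_half_norm_sq (N : ConductanceGraph V) {F : Finset V}
    (hF : (N.full (F : Set V)).graph.Connected) {x y : V} (γ : N.graph.Walk x y)
    (hγ : ∀ s ∈ γ.support, s ∈ F) (C : N.graph.Walk x x) (hC : ∀ s ∈ C.support, s ∈ F) (r : ℝ) :
    N.resistanceIn (F : Set V) x y ≤ 1 / 2 * ‖N.walkVec γ - r • N.walkVec C‖ ^ 2 := by
  obtain ⟨w, f, hR, hfw, hf⟩ :=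
    N.exists_finset_flow hF (hγ x γ.start_mem_support) (hγ y γ.end_mem_support)
  have h1 : inner ℝ (N.walkVec γ - r • N.walkVec C) f = 2 * (w x - w y) := by
    have e : inner ℝ (r • N.walkVec C) f = r * inner ℝ (N.walkVec C) f :=
      real_inner_smul_left (F := N.currentSpace) _ _ _
    rw [inner_sub_left, e,
      N.inner_walkVec γ f w fun d hd => hfw _ (hγ _ (γ.dart_fst_mem_support_of_mem_darts hd)) _
        (hγ _ (γ.dart_snd_mem_support_of_mem_darts hd)),
      N.inner_walkVec C f w fun d hd => hfw _ (hC _ (C.dart_fst_mem_support_of_mem_darts hd)) _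
        (hC _ (C.dart_snd_mem_support_of_mem_darts hd))]
    simp
  have h2 := hf f w hfw
  have h3 := real_inner_mul_inner_self_le (N.walkVec γ - r • N.walkVec C) f
  have h4 : 0 ≤ inner ℝ f f := real_inner_self_nonneg
  rw [h1, h2, real_inner_self_eq_norm_sq] at h3
  rw [h2] at h4
  rw [hR]
  rcases h4.eq_or_lt with h5 | h5
  · have : w x - w y = 0 := by linarith
    rw [this]; positivity
  · nlinarith

theorem Exhaustion.eventually_mem {N : ConductanceGraph V} (K : N.Exhaustion) (z : V) :
    ∀ᶠ k in atTop, z ∈ K.verts k := by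
  obtain ⟨k, hk⟩ := K.exhausts z
  exact eventually_atTop.2 ⟨k, fun j hj => K.mono hj hk⟩

theorem Exhaustion.eventually_support_subset {N : ConductanceGraph V} (K : N.Exhaustion) {x y : V}
    (γ : N.graph.Walk x y) : ∀ᶠ k in atTop, ∀ s ∈ γ.support, s ∈ K.verts k := by
  have h := (eventually_all_finite (List.finite_toSet γ.support)
    (l := (atTop : Filter ℕ)) (p := fun s k => s ∈ K.verts k)).2 fun s _ => K.eventually_mem s
  exact h

theorem Exhaustion.tendsto_resistanceIn {N : ConductanceGraph V} (K : N.Exhaustion) {x y : V}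
    (γ : N.graph.Walk x y) {v : V → ℝ} (hv : N.FiniteEnergy v)
    (hvu : ∀ u, N.FiniteEnergy u → N.energy v u = u x - u y)
    (hγ : N.walkVec γ - N.grad v hv ∈ (N.cycleSpace x).topologicalClosure) :
    Tendsto (fun k => N.resistanceIn (K.verts k : Set V) x y) atTop (𝓝 (N.energy v v)) := by
  have hle : ∀ᶠ k in atTop, N.energy v v ≤ N.resistanceIn (K.verts k : Set V) x y := by
    filter_upwards [K.eventually_mem x, K.eventually_mem y] with k hx hy
    have h := N.sq_sub_le_resistanceIn_mul_energy (K.connected k) hx hy hv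
    rw [← hvu v hv, pow_two] at h
    rcases (N.energy_nonneg v).eq_or_lt with h0 | h0
    · obtain ⟨w, f, hR, hfw, hf⟩ := N.exists_finset_flow (K.connected k) hx hy
      have h1 : 0 ≤ inner ℝ f f := real_inner_self_nonneg
      rw [hf f w hfw, ← hR] at h1
      rw [← h0]
      linarith
    · exact le_of_mul_le_mul_right h h0
  rw [tendsto_order]
  refine ⟨fun a ha => hle.mono fun k hk => ha.trans_le hk, fun a ha => ?_⟩
  -- This open set contains `γ - grad v`, hence also a multiple of one closed walk, and that walk
  -- and `γ` eventually lie in the exhausting sets.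
  have hopen : IsOpen {z : N.currentSpace | 1 / 2 * ‖N.walkVec γ - z‖ ^ 2 < a} :=
    isOpen_lt (by fun_prop) continuous_const
  obtain ⟨z, hz, n, hn, C, hC⟩ := mem_closure_iff.1 (N.cycleSpace_closure_subset x hγ) _ hopen <| by
    rw [Set.mem_ofPred_eq, sub_sub_cancel, norm_grad_sq]
    linarith
  have hz' : z = (n : ℝ)⁻¹ • N.walkVec C := by
    have : (n : ℝ) ≠ 0 := by exact_mod_cast hn.ne'
    rw [← hC, smul_smul, inv_mul_cancel₀ this, one_smul]
  rw [Set.mem_ofPred_eq, hz'] at hz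
  filter_upwards [K.eventually_support_subset γ, K.eventually_support_subset C] with k h1 h2
  exact (N.resistanceIn_le_half_norm_sq (K.connected k) γ h1 C h2 _).trans_lt hz

/-! ### Existence of exhaustions -/

/-- A summable family has countable support, so each vertex has countably many neighbours and each
sphere of walks around `o` is countable. -/
theorem countable_of_connected (N : ConductanceGraph V) (hN : N.graph.Connected) :
    Countable V := by
  obtain ⟨o⟩ := hN.nonempty
  have hnb : ∀ s, {t | N.graph.Adj s t}.Countable := fun s =>
    (N.summable s).countable_support.mono fun t ht => (ne_of_gt ht : N.c s t ≠ 0)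
  have hball : ∀ n : ℕ, {s | ∃ γ : N.graph.Walk s o, γ.length = n}.Countable := by
    intro n
    induction n with
    | zero =>
      refine (Set.countable_singleton o).mono ?_
      rintro s ⟨γ, hγ⟩
      exact SimpleGraph.Walk.eq_of_length_eq_zero hγ
    | succ n ih =>
      refine (ih.biUnion fun s _ => hnb s).mono ?_
      rintro s ⟨γ, hγ⟩
      cases γ with
      | nil => simp at hγ
      | @cons _ t _ h γ =>
        rw [SimpleGraph.Walk.length_cons, Nat.succ_inj] at hγ
        exact Set.mem_biUnion (⟨γ, hγ⟩ : t ∈ {s | ∃ γ : N.graph.Walk s o, γ.length = n}) h.symm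
  rw [← Set.countable_univ_iff]
  refine (Set.countable_iUnion hball).mono fun s _ => ?_
  obtain ⟨γ⟩ := hN.preconnected s o
  exact Set.mem_iUnion.2 ⟨γ.length, γ, rfl⟩

theorem nonempty_exhaustion (N : ConductanceGraph V) (hN : N.graph.Connected) :
    Nonempty N.Exhaustion := by
  classical
  obtain ⟨o⟩ := hN.nonempty
  have : Nonempty V := ⟨o⟩
  have := N.countable_of_connected hN
  obtain ⟨e, he⟩ := exists_surjective_nat V
  let γ : ∀ z, N.graph.Walk o z := fun z => (hN.preconnected o z).some
  -- All the walks start at `o`, so their union is connected; `k + 1` ensures that at least one walk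
  -- is present.
  refine ⟨⟨fun k => (Finset.range (k + 1)).biUnion fun n => (γ (e n)).support.toFinset,
    fun k j hkj => ?_, fun k => ?_, fun z => ?_⟩⟩
  · exact Finset.biUnion_subset_biUnion_of_subset_left _
      (Finset.range_subset_range.2 (Nat.succ_le_succ hkj))
  · have hmem : ∀ n ∈ Finset.range (k + 1), {s | s ∈ (γ (e n)).support} ⊆
        (((Finset.range (k + 1)).biUnion fun n => (γ (e n)).support.toFinset : Finset V) : Set V) :=
      fun n hn s hs => Finset.mem_biUnion.2 ⟨n, hn, List.mem_toFinset.2 hs⟩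
    refine SimpleGraph.induce_connected_of_patches (G := N.graph) o
      (hmem 0 (by simp) (γ (e 0)).start_mem_support) fun {s} hs => ?_
    obtain ⟨n, hn, hs⟩ := Finset.mem_biUnion.1 hs
    refine ⟨_, hmem n hn, (γ (e n)).start_mem_support, List.mem_toFinset.1 hs, ?_⟩
    exact (γ (e n)).connected_induce_support.preconnected _ _
  · obtain ⟨n, rfl⟩ := he z
    exact ⟨n, Finset.mem_biUnion.2 ⟨n, by simp, List.mem_toFinset.2 (γ (e n)).end_mem_support⟩⟩

/-! ### Flows -/

theorem inv_sqrt_mul_c (N : ConductanceGraph V) (s t : V) (a : ℝ) :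
    (√(N.c s t))⁻¹ * (N.c s t * a) = √(N.c s t) * a := by
  rcases (Real.sqrt_nonneg (N.c s t)).eq_or_lt with h | h
  · rw [← h]; simp
  · rw [inv_mul_eq_iff_eq_mul₀ h.ne', ← mul_assoc, sqrt_c_mul_self]

theorem isFlow_of_potential (N : ConductanceGraph V) {x y : V} {v : V → ℝ}
    (hv : N.FiniteEnergy v) (hvu : ∀ u, N.FiniteEnergy u → N.energy v u = u x - u y) :
    N.IsFlow x y fun s t => N.c s t * (v s - v t) := by
  refine ⟨⟨fun s t => ?_, fun s t h => ?_⟩, fun s => ?_⟩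
  · change N.c s t * (v s - v t) = -(N.c t s * (v t - v s))
    rw [N.symm s t]; ring
  · change N.c s t * (v s - v t) = 0
    rw [h, zero_mul]
  · have h := N.hasSum_divergence s (N.grad v hv)
    rw [inner_grad, energy_comm, hvu _ (N.finiteEnergy_delta s), delta_comm s x,
      delta_comm s y, ← mul_assoc, show (1 / 2 * 2 : ℝ) = 1 by norm_num, one_mul] at h
    refine h.congr_fun fun t => ?_
    rw [grad_apply, ← mul_assoc, sqrt_c_mul_self]

theorem isSumOfPathCurrents_of_potential (N : ConductanceGraph V) {x y : V}
    (γ : N.graph.Walk x y) {v : V → ℝ} (hv : N.FiniteEnergy v)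
    (hγ : N.walkVec γ - N.grad v hv ∈ (N.cycleSpace x).topologicalClosure) :
    N.IsSumOfPathCurrents x y fun s t => N.c s t * (v s - v t) := by
  have h : ∀ s t, (N.grad v hv).1 (s, t) = (√(N.c s t))⁻¹ * (N.c s t * (v s - v t)) :=
    fun s t => by rw [inv_sqrt_mul_c, grad_apply]
  obtain ⟨ξ, hξ⟩ := N.exists_hasSum_walkVec γ _ hγ
  exact ⟨N.finiteDissipation_of_vec _ h, ξ, (N.tendsto_dissipation_iff_hasSum _ h ξ).2 hξ⟩

theorem dissipation_of_potential (N : ConductanceGraph V) {v : V → ℝ} (hv : N.FiniteEnergy v) :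
    (N.dissipation fun s t => N.c s t * (v s - v t)) = N.energy v v := by
  rw [N.dissipation_of_vec (N.grad v hv) fun s t => by rw [inv_sqrt_mul_c, grad_apply],
    norm_grad_sq]
  ring

theorem dissipation_nonneg (N : ConductanceGraph V) (I : V → V → ℝ) : 0 ≤ N.dissipation I :=
  mul_nonneg (by norm_num) <| tsum_nonneg fun _ =>
    mul_nonneg (inv_nonneg.2 (N.nonneg _ _)) (sq_nonneg _)

/-- Every path pairs with `grad u` to `2 (u x - u y)`, so only `∑ ξ` matters. Testing with `delta
x`, where the pairing is twice the outflow at `x`, shows `∑ ξ = 1`. -/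
theorem inner_grad_of_flow (N : ConductanceGraph V) {x y : V} (hxy : x ≠ y) {I : V → V → ℝ}
    (hI : N.IsFlow x y I) {f : N.currentSpace}
    (hf : ∀ s t, f.1 (s, t) = (√(N.c s t))⁻¹ * I s t) {ξ : N.graph.Walk x y → ℝ}
    (hξ : HasSum (fun γ => ξ γ • N.walkVec γ) f) {u : V → ℝ} (hu : N.FiniteEnergy u) :
    inner ℝ (N.grad u hu) f = 2 * (u x - u y) := by
  have key : ∀ (u : V → ℝ) (hu : N.FiniteEnergy u),
      HasSum (fun γ => ξ γ * (2 * (u x - u y))) (inner ℝ (N.grad u hu) f) := by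
    intro u hu
    have h := hξ.mapL (innerSL ℝ (N.grad u hu))
    refine h.congr_fun fun γ => ?_
    rw [innerSL_apply_apply, real_inner_smul_right (F := N.currentSpace), real_inner_comm, inner_walkVec_grad]
  have h1 : inner ℝ (N.grad (delta x) (N.finiteEnergy_delta x)) f = 2 := by
    have h2 := (hI.2 x).unique ((N.hasSum_divergence x f).congr_fun fun t => ?_)
    · rw [delta_self, delta_of_ne hxy] at h2
      linarith
    · rw [hf]
      by_cases h0 : N.c x t = 0
      · rw [hI.1.2 x t h0, h0]; simp
      · have : 0 < √(N.c x t) := Real.sqrt_pos.2 (lt_of_le_of_ne (N.nonneg x t) (Ne.symm h0))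
        field_simp
  have h2 := key (delta x) (N.finiteEnergy_delta x)
  rw [h1, delta_self, delta_of_ne hxy.symm] at h2
  have h3 : HasSum ξ 1 := by
    have := h2.mul_right (1 / 2)
    norm_num at this
    simpa using this
  have h4 := (key u hu).unique (h3.mul_right (2 * (u x - u y)))
  rw [h4, one_mul]

theorem energy_le_dissipation_of_flow (N : ConductanceGraph V) {x y : V} {I : V → V → ℝ}
    (hI : N.IsFlow x y I) (hI' : N.IsSumOfPathCurrents x y I) {v : V → ℝ}
    (hv : N.FiniteEnergy v) (hvu : ∀ u, N.FiniteEnergy u → N.energy v u = u x - u y) :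
    N.energy v v ≤ N.dissipation I := by
  rcases eq_or_ne x y with rfl | hxy
  · rw [hvu v hv, sub_self]
    exact N.dissipation_nonneg I
  obtain ⟨hD, ξ, hξ⟩ := hI'
  obtain ⟨f, hf⟩ := N.exists_vec_of_current hI.1 hD
  have h1 := N.inner_grad_of_flow hxy hI hf ((N.tendsto_dissipation_iff_hasSum f hf ξ).1 hξ) hv
  have h2 := real_inner_mul_inner_self_le (N.grad v hv) f
  rw [h1, ← hvu v hv, inner_grad, real_inner_self_eq_norm_sq] at h2
  rw [N.dissipation_of_vec f hf]
  rcases (N.energy_nonneg v).eq_or_lt with h0 | h0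
  · rw [← h0]; positivity
  · nlinarith

/-! ### The norm of the evaluation difference -/

theorem abs_sub_sq_le (N : ConductanceGraph V) {x y : V} {v : V → ℝ}
    (hv : N.FiniteEnergy v) (hvu : ∀ u, N.FiniteEnergy u → N.energy v u = u x - u y) {u : V → ℝ}
    (hu : N.FiniteEnergy u) : |u x - u y| ^ 2 ≤ N.energy v v * N.energy u u := by
  rw [sq_abs, ← hvu u hu]
  exact N.energy_sq_le hv hu

theorem energy_pos_of_potential (N : ConductanceGraph V) {x y : V} (hxy : x ≠ y) {v : V → ℝ}
    (hv : N.FiniteEnergy v) (hvu : ∀ u, N.FiniteEnergy u → N.energy v u = u x - u y) :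
    0 < N.energy v v := by
  have h := N.abs_sub_sq_le hv hvu (N.finiteEnergy_delta x)
  rw [delta_self, delta_of_ne hxy.symm] at h
  refine (N.energy_nonneg v).lt_of_ne fun h0 => ?_
  rw [← h0] at h
  norm_num at h

theorem finiteEnergy_sub_const (N : ConductanceGraph V) {u : V → ℝ} (hu : N.FiniteEnergy u)
    (a : ℝ) : N.FiniteEnergy fun s => u s - a := by
  simp only [FiniteEnergy, sub_sub_sub_cancel_right]
  exact hu

theorem energy_sub_const (N : ConductanceGraph V) (u : V → ℝ) (a : ℝ) :
    N.energy (fun s => u s - a) (fun s => u s - a) = N.energy u u := by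
  simp only [energy, sub_sub_sub_cancel_right]

theorem isLeast_energy (N : ConductanceGraph V) {x y : V} (hxy : x ≠ y) {v : V → ℝ}
    (hv : N.FiniteEnergy v) (hvu : ∀ u, N.FiniteEnergy u → N.energy v u = u x - u y) :
    IsLeast {e : ℝ | ∃ u : V → ℝ, N.FiniteEnergy u ∧ u x = 1 ∧ u y = 0 ∧ e = N.energy u u}
      (N.energy v v)⁻¹ := by
  have hR := N.energy_pos_of_potential hxy hv hvu
  have hRv := hvu v hv
  constructor
  -- Normalised by `v x - v y = E(v)`.
  · refine ⟨(N.energy v v)⁻¹ • fun s => v s - v y,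
      N.finiteEnergy_smul (N.finiteEnergy_sub_const hv _) _, ?_, ?_, ?_⟩
    · rw [Pi.smul_apply, ← hRv, smul_eq_mul, inv_mul_cancel₀ hR.ne']
    · rw [Pi.smul_apply, sub_self, smul_zero]
    · rw [energy_smul_smul, energy_sub_const]
      field_simp
  · rintro _ ⟨u, hu, hux, huy, rfl⟩
    have h := N.abs_sub_sq_le hv hvu hu
    rw [hux, huy] at h
    rw [inv_le_iff_one_le_mul₀' hR]
    simpa using h

theorem isLeast_norm_bound (N : ConductanceGraph V) {x y : V} {v : V → ℝ}
    (hv : N.FiniteEnergy v) (hvu : ∀ u, N.FiniteEnergy u → N.energy v u = u x - u y) :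
    IsLeast {κ : ℝ | 0 ≤ κ ∧ ∀ v : V → ℝ, N.FiniteEnergy v →
      |v x - v y| ^ 2 ≤ κ * N.energy v v} (N.energy v v) := by
  refine ⟨⟨N.energy_nonneg v, fun u hu => N.abs_sub_sq_le hv hvu hu⟩, ?_⟩
  rintro κ ⟨hκ, h⟩
  have h1 := h v hv
  rw [sq_abs, ← hvu v hv, pow_two] at h1
  rcases (N.energy_nonneg v).eq_or_lt with h0 | h0
  · rwa [← h0]
  · exact le_of_mul_le_mul_right h1 h0

theorem isGreatest_sq_sub (N : ConductanceGraph V) {x y : V} {v : V → ℝ}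
    (hv : N.FiniteEnergy v) (hvu : ∀ u, N.FiniteEnergy u → N.energy v u = u x - u y) :
    IsGreatest {r : ℝ | ∃ v : V → ℝ, N.FiniteEnergy v ∧ N.energy v v ≤ 1 ∧
      r = |v x - v y| ^ 2} (N.energy v v) := by
  have hR := N.energy_nonneg v
  constructor
  · have hs : (√(N.energy v v))⁻¹ ^ 2 = (N.energy v v)⁻¹ := by rw [inv_pow, Real.sq_sqrt hR]
    -- If `E(v) = 0`, then `0⁻¹ = 0` makes this the zero function, which attains the supremum `0`.
    refine ⟨(√(N.energy v v))⁻¹ • v, N.finiteEnergy_smul hv _, ?_, ?_⟩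
    · rw [energy_smul_smul, hs]
      exact inv_mul_le_one
    · rw [Pi.smul_apply, Pi.smul_apply, ← smul_sub, ← hvu v hv, sq_abs, smul_eq_mul, mul_pow, hs]
      rcases hR.eq_or_lt with h0 | h0
      · rw [← h0]; simp
      · field_simp
  · rintro _ ⟨u, hu, hu1, rfl⟩
    exact (N.abs_sub_sq_le hv hvu hu).trans (mul_le_of_le_one_right hR hu1)

/-! ### The energy kernel -/

theorem IsEnergyKernel.eq_add_const {N : ConductanceGraph V} (hN : N.graph.Connected) {o z : V}
    {v w : V → ℝ} (hv : N.IsEnergyKernel o z v) (hw : N.IsEnergyKernel o z w) :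
    ∃ a : ℝ, ∀ s, v s = w s + a := by
  have hvw := N.finiteEnergy_sub hv.1 hw.1
  have h0 : N.energy (v - w) (v - w) = 0 := by
    rw [N.energy_sub_left hv.1 hw.1 hvw, hv.2 _ hvw, hw.2 _ hvw, sub_self]
  refine ⟨v o - w o, fun s => ?_⟩
  have h := N.eq_of_energy_eq_zero hN hvw h0 s o
  simp only [Pi.sub_apply] at h
  linarith

theorem IsEnergyKernel.energy_sub {N : ConductanceGraph V} {o x y : V} {vx vy : V → ℝ}
    (hx : N.IsEnergyKernel o x vx) (hy : N.IsEnergyKernel o y vy) {u : V → ℝ}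
    (hu : N.FiniteEnergy u) : N.energy (vx - vy) u = u x - u y := by
  rw [N.energy_sub_left hx.1 hy.1 hu, hx.2 u hu, hy.2 u hu]
  ring

end ConductanceGraph

theorem mainTheorem1 {V : Type*} (N : ConductanceGraph V) (hN : N.graph.Connected) (o x y : V) :
    -- the energy kernel exists and is unique as a family of functions modulo constants
    (∀ z, ∃ v, N.IsEnergyKernel o z v) ∧
    (∀ z v w, N.IsEnergyKernel o z v → N.IsEnergyKernel o z w → ∃ a : ℝ, ∀ s, v s = w s + a) ∧
    -- the free resistance exists
    ∃ R : ℝ, N.IsFreeResistance x y R ∧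
      -- formulas through the energy kernel, for arbitrary representatives
      (∀ vx vy : V → ℝ, N.IsEnergyKernel o x vx → N.IsEnergyKernel o y vy →
        R = (vx x - vx y) - (vy x - vy y) ∧ R = N.energy (vx - vy) (vx - vy)) ∧
      -- minimal dissipation
      IsLeast {d : ℝ | ∃ I : V → V → ℝ, N.IsFlow x y I ∧ N.IsSumOfPathCurrents x y I ∧
        d = N.dissipation I} R ∧
      -- reciprocal of the minimal energy
      (x ≠ y → ∃ m : ℝ, 0 < m ∧
        IsLeast {e : ℝ | ∃ u : V → ℝ, N.FiniteEnergy u ∧ u x = 1 ∧ u y = 0 ∧ e = N.energy u u} m ∧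
        R = 1 / m) ∧
      -- squared norm of `v ↦ v x - v y` on the energy space, as an infimum and as a supremum
      IsGLB {κ : ℝ | 0 ≤ κ ∧ ∀ v : V → ℝ, N.FiniteEnergy v →
        |v x - v y| ^ 2 ≤ κ * N.energy v v} R ∧
      IsLUB {r : ℝ | ∃ v : V → ℝ, N.FiniteEnergy v ∧ N.energy v v ≤ 1 ∧
        r = |v x - v y| ^ 2} R := by
  refine ⟨fun z => ?_, fun z v w hv hw => hv.eq_add_const hN hw, ?_⟩
  · obtain ⟨γ⟩ := hN.preconnected z o
    obtain ⟨v, hv, hvu, -⟩ := N.exists_potential_of_walk hN γ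
    exact ⟨v, hv, hvu⟩
  obtain ⟨γ⟩ := hN.preconnected x y
  obtain ⟨v, hv, hvu, hvγ⟩ := N.exists_potential_of_walk hN γ
  refine ⟨N.energy v v,
    ⟨N.nonempty_exhaustion hN, fun K => K.tendsto_resistanceIn γ hv hvu hvγ⟩,
    fun vx vy hx hy => ?_, ⟨?_, ?_⟩, fun hxy => ?_, (N.isLeast_norm_bound hv hvu).isGLB,
    (N.isGreatest_sq_sub hv hvu).isLUB⟩
  · have hxy := N.finiteEnergy_sub hx.1 hy.1
    -- Both `v` and `vx - vy` represent `u ↦ u x - u y`; evaluating `E(vx - vy, v)` with each of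
    -- them identifies `E(v)` with the drop of `vx - vy` from `x` to `y`.
    have h1 := hx.energy_sub hy hv
    rw [N.energy_comm, hvu _ hxy, ← hvu v hv] at h1
    rw [hx.energy_sub hy hxy, ← h1]
    simp only [Pi.sub_apply]
    exact ⟨by ring, trivial⟩
  · exact ⟨_, N.isFlow_of_potential hv hvu, N.isSumOfPathCurrents_of_potential γ hv hvγ,
      (N.dissipation_of_potential hv).symm⟩
  · rintro _ ⟨I, hI, hI', rfl⟩
    exact N.energy_le_dissipation_of_flow hI hI' hv hvu
  · exact ⟨_, inv_pos.2 (N.energy_pos_of_potential hxy hv hvu), N.isLeast_energy hxy hv hvu,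
      by rw [one_div, inv_inv]⟩
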